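/- Let $f,g:\mathbb{R}^n\to(-\infty,\infty]$ be proper, convex and lower semicontinuous, and suppose that the inclusion $0\in\partial f(x)+\partial g(x)$ has a solution. An $\mathcal F$-procedure for $f$ is a map $\mathcal F$ such that for all $p,z,\bar x\in\mathbb{R}^n$ and $c>0$ the pairs $(x^\ell,y^\ell)=\mathcal F(p,z,c,\bar x,\ell)\in\mathbb{R}^n\times\mathbb{R}^n$, $\ell=1,2,\dots$, satisfy $y^\ell\to 0$ and $y^\ell\in\partial_x\big[f(x)+\langle p,x\rangle+\tfrac c2\|x-z\|^2\big]_{x=x^\ell}$ for all $\ell\ge 1$. Let an $\mathcal F$-procedure $\mathcal F$ be given. **Algorithm.** Choose $c>0$, $0\le\alpha,\sigma<1$, $0<\underline\rho<\overline\rho<2$ and $(x^0,z^0,p^0)=(x^{-1},z^{-1},p^{-1})\in(\mathbb{R}^n)^3$. For $k=0,1,2,\dots$: choose $\alpha_k\in[0,\alpha]$ and set $$(\hat x^k,\hat z^k,\hat p^k)=(x^k,z^k,p^k)+\alpha_k\big[(x^k,z^k,p^k)-(x^{k-1},z^{k-1},p^{k-1})\big].$$ For $\ell=1,2,\dots$ compute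 $$(x^{k,\ell},y^{k,\ell})=\mathcal F(\hat p^k,\hat z^k,c,\hat x^k,\ell),\qquad p^{k,\ell}=\hat p^k+c(x^{k,\ell}-\hat z^k)-y^{k,\ell},$$ $$z^{k,\ell}=\operatorname{argmin}_{z}\Big\{g(z)-\langle p^{k,\ell},z\rangle+\tfrac c2\|x^{k,\ell}-z\|^2\Big\},$$ and end this inner loop as soon as $$\|y^{k,\ell}\|^2\le\sigma^2\Big(\|p^{k,\ell}-\hat p^k-c(z^{k,\ell}-\hat z^k)\|^2+c^2\|x^{k,\ell}-z^{k,\ell}\|^2\Big).$$ With this $\ell$, stop if $x^{k,\ell}=z^{k,\ell}$. Otherwise choose $\rho_k\in[\underline\rho,\overline\rho]$ and set $x^{k+1}=x^{k,\ell}$, $z^{k+1}=z^{k,\ell}$, $$\theta_{k+1}=\frac{\langle c(\hat z^k-z^{k,\ell})-(\hat p^k-p^{k,\ell}),\,x^{k,\ell}-z^{k,\ell}\rangle}{c\|x^{k,\ell}-z^{k,\ell}\|^2},$$ $$p^{k+1}=\hat p^k+c\big[(1-\rho_k\theta_{k+1})z^{k+1}+\rho_k\theta_{k+1}x^{k+1}-\hat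 z^k\big].$$ **Theorem.** Consider any execution of the algorithm for which, for some $\beta$, $$0\le\alpha_k\le\alpha_{k+1}\le\alpha<\beta<1\quad\text{for all }k\ge 0,\qquad \overline\rho=\frac{2(\beta-1)^2}{2(\beta-1)^2+3\beta-1}.$$ (a) If the outer loop (over $k$) executes infinitely often, each inner loop (over $\ell$) ending after finitely many iterations, then $\{x^k\}$ and $\{z^k\}$ both converge to some solution $x^*$ of $0\in\partial f(x)+\partial g(x)$, and $\{p^k\}$ converges to some $p^*\in\partial g(x^*)$ with $-p^*\in\partial f(x^*)$. (b) If $\sigma>0$ and the outer loop executes only finitely often, ending with $k=\bar k$ and with the inner loop at $\bar k$ executing infinitely often, then $\{x^{\bar k,\ell}\}_\ell$ and $\{z^{\bar k,\ell}\}_\ell$ both converge to some solution $x^*$ of $0\in\partial f(x)+\partial g(x)$, and $\{p^{\bar k,\ell}\}_\ell$ converges to some $p^*\in\partial g(x^*)$ with $-p^*\in\partial f(x^*)$. (c) If the inner loop of an iteration $k$ ends at $\ell$ with $p^{k,\ell}-\hat p^k=c(z^{k,\ell}-\hat z^k)$ or $x^{k,\ell}=z^{k,\ell}$, then $x^{k,\ell}=z^{k,\ell}$,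 and this point is a solution of $0\in\partial f(x)+\partial g(x)$. -/

import Mathlib

open Filter Topology
open scoped Pointwise

namespace InertialADMM

/-- The space `ℝⁿ` with its Euclidean norm and inner product. -/
abbrev Vec (n : ℕ) : Type := EuclideanSpace ℝ (Fin n)

/-- A proper, convex and lower semicontinuous function with values in `(-∞, ∞]`;
convexity is convexity of the epigraph. -/
structure IsProperConvexLsc {n : ℕ} (f : Vec n → EReal) : Prop where
  ne_bot : ∀ x, f x ≠ ⊥
  exists_ne_top : ∃ x, f x ≠ ⊤
  convex_epigraph : Convex ℝ {q : Vec n × ℝ | f q.1 ≤ (q.2 : EReal)}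
  lsc : LowerSemicontinuous f

/-- The convex subdifferential `∂f(x) = {u | f(y) ≥ f(x) + ⟨u, y - x⟩ for all y}`. -/
def subdiff {n : ℕ} (f : Vec n → EReal) (x : Vec n) : Set (Vec n) :=
  {u | ∀ y, f x + ((inner ℝ u (y - x) : ℝ) : EReal) ≤ f y}

/-- `x` solves the inclusion `0 ∈ ∂f(x) + ∂g(x)` (Minkowski sum of sets). -/
def IsSolution {n : ℕ} (f g : Vec n → EReal) (x : Vec n) : Prop :=
  (0 : Vec n) ∈ subdiff f x + subdiff g x

/-- The objective `x ↦ f(x) + ⟨p, x⟩ + (c/2)‖x - z‖²`. -/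
noncomputable def augObjective {n : ℕ} (f : Vec n → EReal) (p z : Vec n) (c : ℝ) :
    Vec n → EReal :=
  fun x => f x + ((inner ℝ p x + c / 2 * ‖x - z‖ ^ 2 : ℝ) : EReal)

/-- `F` is an `ℱ`-procedure for the subproblems `min_x f(x) + ⟨p, x⟩ + (c/2)‖x - z‖²`:
`(xˡ, yˡ) = F p z c x̄ ℓ`, `ℓ = 1, 2, …`, satisfies `yˡ → 0` and
`yˡ ∈ ∂ₓ[f(x) + ⟨p, x⟩ + (c/2)‖x - z‖²]` at `x = xˡ`, for all `p z x̄` and all `c > 0`.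
The values of `F` at `c ≤ 0` or at `ℓ = 0` are irrelevant. -/
def IsFProcedure {n : ℕ} (f : Vec n → EReal)
    (F : Vec n → Vec n → ℝ → Vec n → ℕ → Vec n × Vec n) : Prop :=
  ∀ (p z xbar : Vec n) (c : ℝ), 0 < c →
    Tendsto (fun l => (F p z c xbar l).2) atTop (𝓝 0) ∧
    ∀ l, 1 ≤ l → (F p z c xbar l).2 ∈ subdiff (augObjective f p z c) (F p z c xbar l).1

/-- The constants of the method, within the ranges that the method prescribes. -/
structure Params where
  c : ℝ
  α : ℝ
  σ : ℝ
  ρlo : ℝ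
  ρhi : ℝ
  c_pos : 0 < c
  α_nonneg : 0 ≤ α
  α_lt_one : α < 1
  σ_nonneg : 0 ≤ σ
  σ_lt_one : σ < 1
  ρlo_pos : 0 < ρlo
  ρlo_lt_ρhi : ρlo < ρhi
  ρhi_lt_two : ρhi < 2

/-- Storage for all quantities of an execution: the chosen `α k`, `ρ k`, the outer iterates
`x k`, `z k`, `p k` and the inner iterates `xi k l`, `yi k l`, `zi k l`, `pi k l` (that is
`x^{k,ℓ}`, `y^{k,ℓ}`, `z^{k,ℓ}`, `p^{k,ℓ}`).  Entries with indices that the execution does not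
reach are placeholders. -/
structure Trace (n : ℕ) where
  α : ℕ → ℝ
  ρ : ℕ → ℝ
  x : ℕ → Vec n
  z : ℕ → Vec n
  p : ℕ → Vec n
  xi : ℕ → ℕ → Vec n
  yi : ℕ → ℕ → Vec n
  zi : ℕ → ℕ → Vec n
  pi : ℕ → ℕ → Vec n

/-- The previous iterate `u^{k-1}`, with the initialization `u^{-1} = u^0`. -/
def prevIterate {n : ℕ} (u : ℕ → Vec n) : ℕ → Vec n
  | 0 => u 0
  | k + 1 => u k

/-- The extrapolated point `u^k + a_k (u^k - u^{k-1})`. -/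
def extrapolate {n : ℕ} (a : ℕ → ℝ) (u : ℕ → Vec n) (k : ℕ) : Vec n :=
  u k + a k • (u k - prevIterate u k)

namespace Trace

variable {n : ℕ}

/-- `x̂^k` -/
def xHat (t : Trace n) (k : ℕ) : Vec n := extrapolate t.α t.x k

/-- `ẑ^k` -/
def zHat (t : Trace n) (k : ℕ) : Vec n := extrapolate t.α t.z k

/-- `p̂^k` -/
def pHat (t : Trace n) (k : ℕ) : Vec n := extrapolate t.α t.p k

/-- The body of the inner loop at `(k, ℓ)`: one step of the `ℱ`-procedure, the definition of
`p^{k,ℓ}`, and `z^{k,ℓ} = argmin_z g(z) - ⟨p^{k,ℓ}, z⟩ + (c/2)‖x^{k,ℓ} - z‖²`. -/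
structure InnerStep (t : Trace n) (P : Params) (g : Vec n → EReal)
    (F : Vec n → Vec n → ℝ → Vec n → ℕ → Vec n × Vec n) (k l : ℕ) : Prop where
  xy_eq : (t.xi k l, t.yi k l) = F (t.pHat k) (t.zHat k) P.c (t.xHat k) l
  p_eq : t.pi k l = t.pHat k + P.c • (t.xi k l - t.zHat k) - t.yi k l
  z_argmin : IsMinOn
    (fun z => g z + ((-inner ℝ (t.pi k l) z + P.c / 2 * ‖t.xi k l - z‖ ^ 2 : ℝ) : EReal))
    Set.univ (t.zi k l)

/-- The relative-error test that ends the inner loop. -/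
def Accepts (t : Trace n) (P : Params) (k l : ℕ) : Prop :=
  ‖t.yi k l‖ ^ 2 ≤ P.σ ^ 2 *
    (‖t.pi k l - t.pHat k - P.c • (t.zi k l - t.zHat k)‖ ^ 2
      + P.c ^ 2 * ‖t.xi k l - t.zi k l‖ ^ 2)

/-- The inner loop of outer iteration `k` runs through `1, …, l` and ends at `l`, the first
index that passes the test. -/
structure InnerEndsAt (t : Trace n) (P : Params) (g : Vec n → EReal)
    (F : Vec n → Vec n → ℝ → Vec n → ℕ → Vec n × Vec n) (k l : ℕ) : Prop where
  one_le : 1 ≤ l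
  steps : ∀ j, 1 ≤ j → j ≤ l → t.InnerStep P g F k j
  rejected : ∀ j, 1 ≤ j → j < l → ¬ t.Accepts P k j
  accepted : t.Accepts P k l

/-- The step length `θ_{k+1}` computed from the accepted inner iterate `(k, l)`. -/
noncomputable def theta (t : Trace n) (P : Params) (k l : ℕ) : ℝ :=
  inner ℝ (P.c • (t.zHat k - t.zi k l) - (t.pHat k - t.pi k l)) (t.xi k l - t.zi k l)
    / (P.c * ‖t.xi k l - t.zi k l‖ ^ 2)

/-- Outer iteration `k` is carried out completely: `α_k ∈ [0, α]`, the inner loop ends at `l`,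
the method does not stop, `ρ_k ∈ [ρlo, ρhi]`, and the next outer iterates are set. -/
structure OuterStep (t : Trace n) (P : Params) (g : Vec n → EReal)
    (F : Vec n → Vec n → ℝ → Vec n → ℕ → Vec n × Vec n) (k l : ℕ) : Prop where
  α_mem : t.α k ∈ Set.Icc 0 P.α
  inner_ends : t.InnerEndsAt P g F k l
  not_stop : t.xi k l ≠ t.zi k l
  ρ_mem : t.ρ k ∈ Set.Icc P.ρlo P.ρhi
  x_next : t.x (k + 1) = t.xi k l
  z_next : t.z (k + 1) = t.zi k l
  p_next : t.p (k + 1) = t.pHat k + P.c •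
    ((1 - t.ρ k * t.theta P k l) • t.z (k + 1) + (t.ρ k * t.theta P k l) • t.x (k + 1)
      - t.zHat k)

/-- The outer loop executes infinitely often, every inner loop being finite. -/
def RunsForever (t : Trace n) (P : Params) (g : Vec n → EReal)
    (F : Vec n → Vec n → ℝ → Vec n → ℕ → Vec n × Vec n) : Prop :=
  ∃ l : ℕ → ℕ, ∀ k, t.OuterStep P g F k (l k)

/-- The outer iterations `0, …, K - 1` are carried out completely and outer iteration `K` is
entered. -/
structure Reaches (t : Trace n) (P : Params) (g : Vec n → EReal)
    (F : Vec n → Vec n → ℝ → Vec n → ℕ → Vec n × Vec n) (K : ℕ) : Prop where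
  previous : ∀ k, k < K → ∃ l, t.OuterStep P g F k l
  α_mem : t.α K ∈ Set.Icc 0 P.α

/-- Outer iteration `K` is the last one, and its inner loop never ends. -/
structure InnerRunsForever (t : Trace n) (P : Params) (g : Vec n → EReal)
    (F : Vec n → Vec n → ℝ → Vec n → ℕ → Vec n × Vec n) (K : ℕ) : Prop where
  reaches : t.Reaches P g F K
  steps : ∀ l, 1 ≤ l → t.InnerStep P g F K l
  rejected : ∀ l, 1 ≤ l → ¬ t.Accepts P K l

/-- The inner loop of outer iteration `K` ends at `l`, with `p^{K,l} - p̂^K = c (z^{K,l} - ẑ^K)`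
or `x^{K,l} = z^{K,l}`. -/
structure StopsAt (t : Trace n) (P : Params) (g : Vec n → EReal)
    (F : Vec n → Vec n → ℝ → Vec n → ℕ → Vec n × Vec n) (K l : ℕ) : Prop where
  reaches : t.Reaches P g F K
  inner_ends : t.InnerEndsAt P g F K l
  halts : t.pi K l - t.pHat K = P.c • (t.zi K l - t.zHat K) ∨ t.xi K l = t.zi K l

end Trace

end InertialADMM

namespace InertialADMM

variable {n : ℕ}

/-! ### Convex subdifferentials -/

/-! The method is an inertial projection method for the single variable `w = c z - p`. For an
accepted inner iterate put `u = c (x - z)` and `r = p - p̂ - c (z - ẑ)`. Monotonicity of the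
subdifferentials (`IsKT.inner_nonpos`) gives a half-space with normal `u` and boundary through `c z
- p = ŵ - r` that contains every `c x* - p*` with `(x*, p*)` a Kuhn–Tucker pair. Since `r = u - y`,
the error test forces `⟨r, u⟩ ≥ (1 - σ²)/2 (‖r‖² + ‖u‖²)`, so `ŵ` lies outside, `θ` is the exact
projection coefficient, and the step length bounds both residuals `r` and `u`.

`inertial_fejer` absorbs the extrapolation into a decreasing Lyapunov quantity, provided `α (1 + α)
< (2/ρ̄ - 1)(1 - α)²`, which the formula for `ρ̄` yields (`inertia_lt_relaxation`). Steps then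
vanish and distances to all `c x* - p*` converge, so an Opial argument gives convergence of `w`.
Finally `c x - p` determines `x` in a Lipschitz way, so `exists_isKT_of_tendsto` recovers the
separate limits. It also settles an endless inner loop, where `y → 0` and the failed test forces `x
- z → 0`. -/

lemma IsProperConvexLsc.exists_coe_of_mem_subdiff {f : Vec n → EReal} (hf : IsProperConvexLsc f)
    {x u : Vec n} (h : u ∈ subdiff f x) : ∃ a : ℝ, f x = (a : EReal) := by
  obtain ⟨y, hy⟩ := hf.exists_ne_top
  have hx : f x ≠ ⊤ := by
    intro hx
    have := h y
    rw [hx, EReal.top_add_coe, top_le_iff] at this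
    exact hy this
  exact ⟨(f x).toReal, (EReal.coe_toReal hx (hf.ne_bot x)).symm⟩

lemma subdiff_monotone {f : Vec n → EReal} (hf : IsProperConvexLsc f)
    {x y u v : Vec n} (hu : u ∈ subdiff f x) (hv : v ∈ subdiff f y) :
    0 ≤ inner ℝ (x - y) (u - v) := by
  obtain ⟨a, ha⟩ := hf.exists_coe_of_mem_subdiff hu
  obtain ⟨b, hb⟩ := hf.exists_coe_of_mem_subdiff hv
  have h1 := hu y
  have h2 := hv x
  rw [ha, hb, ← EReal.coe_add, EReal.coe_le_coe_iff] at h1 h2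
  have e1 : inner ℝ u (y - x) = - inner ℝ (x - y) u := by
    rw [← neg_sub x y, inner_neg_right, real_inner_comm]
  have e2 : inner ℝ v (x - y) = inner ℝ (x - y) v := real_inner_comm _ _
  rw [inner_sub_right]
  linarith

lemma augObjective_add_smul (p z x d : Vec n) (c s : ℝ) :
    inner ℝ p (x + s • d) + c / 2 * ‖x + s • d - z‖ ^ 2
      = inner ℝ p x + c / 2 * ‖x - z‖ ^ 2 + s * inner ℝ (p + c • (x - z)) d
        + c / 2 * s ^ 2 * ‖d‖ ^ 2 := by
  have : x + s • d - z = (x - z) + s • d := by abel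
  rw [this, norm_add_sq_real, inner_add_right, inner_smul_right, inner_smul_right, norm_smul,
    inner_add_left, inner_smul_left, mul_pow, Real.norm_eq_abs, sq_abs]
  simp only [conj_trivial]
  ring

/-- The exact sum rule for a quadratic perturbation. -/
lemma sub_mem_subdiff_of_mem_subdiff_augObjective {f : Vec n → EReal} (hf : IsProperConvexLsc f)
    {p z x v : Vec n} {c : ℝ} (h : v ∈ subdiff (augObjective f p z c) x) :
    v - p - c • (x - z) ∈ subdiff f x := by
  have hx : f x ≠ ⊤ := by
    intro hx
    obtain ⟨y, hy⟩ := hf.exists_ne_top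
    have := h y
    simp only [augObjective] at this
    rw [hx, EReal.top_add_coe, EReal.top_add_coe, top_le_iff,
      ← EReal.coe_toReal hy (hf.ne_bot y), ← EReal.coe_add] at this
    exact EReal.coe_ne_top _ this
  obtain ⟨a, ha⟩ : ∃ a : ℝ, f x = (a : EReal) :=
    ⟨(f x).toReal, (EReal.coe_toReal hx (hf.ne_bot x)).symm⟩
  intro y
  by_cases hy : f y = ⊤
  · rw [hy]; exact le_top
  obtain ⟨b, hb⟩ : ∃ b : ℝ, f y = (b : EReal) :=
    ⟨(f y).toReal, (EReal.coe_toReal hy (hf.ne_bot y)).symm⟩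
  rw [ha, hb, ← EReal.coe_add, EReal.coe_le_coe_iff]
  set d := y - x with hd
  -- Compare at `x + s d`: convexity bounds `f` there by `(1 - s) a + s b`, and after division by
  -- `s` the quadratic leaves only an error of order `s`.
  have key : ∀ s : ℝ, 0 < s → s ≤ 1 →
      a + inner ℝ (v - p - c • (x - z)) d - b ≤ s * (c / 2 * ‖d‖ ^ 2) := by
    intro s hs hs1
    have hconv := hf.convex_epigraph (x := (x, a)) (by simp [ha]) (y := (y, b)) (by simp [hb])
      (sub_nonneg.2 hs1) hs.le (by ring)
    have hpt : (1 - s) • x + s • y = x + s • d := by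
      rw [hd, smul_sub, sub_smul, one_smul]; abel
    simp only [Set.mem_ofPred_eq, Prod.smul_mk, Prod.mk_add_mk, smul_eq_mul, hpt] at hconv
    have h1 := h (x + s • d)
    simp only [augObjective] at h1
    have h2 := h1.trans (add_le_add_left hconv _)
    rw [ha, ← EReal.coe_add, ← EReal.coe_add, ← EReal.coe_add, EReal.coe_le_coe_iff,
      augObjective_add_smul, add_sub_cancel_left, inner_smul_right] at h2
    have e : inner ℝ (v - p - c • (x - z)) d = inner ℝ v d - inner ℝ (p + c • (x - z)) d := by
      rw [sub_sub, inner_sub_left]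
    rw [e]
    have : s * (a + (inner ℝ v d - inner ℝ (p + c • (x - z)) d) - b)
        ≤ s * (s * (c / 2 * ‖d‖ ^ 2)) := by nlinarith
    exact le_of_mul_le_mul_left this hs
  have hlim : Tendsto (fun s : ℝ => s * (c / 2 * ‖d‖ ^ 2)) (𝓝[>] 0) (𝓝 0) := by
    have : Tendsto (fun s : ℝ => s * (c / 2 * ‖d‖ ^ 2)) (𝓝 0) (𝓝 (0 * (c / 2 * ‖d‖ ^ 2))) :=
      (continuous_id.mul continuous_const).tendsto 0
    rw [zero_mul] at this
    exact this.mono_left nhdsWithin_le_nhds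
  have : a + inner ℝ (v - p - c • (x - z)) d - b ≤ 0 := by
    refine ge_of_tendsto hlim ?_
    filter_upwards [Ioc_mem_nhdsGT (zero_lt_one (α := ℝ))] with s hs using key s hs.1 hs.2
  linarith

lemma mem_subdiff_of_isMinOn {g : Vec n → EReal} (hg : IsProperConvexLsc g) {p x z : Vec n} {c : ℝ}
    (h : IsMinOn (fun z => g z + ((-inner ℝ p z + c / 2 * ‖x - z‖ ^ 2 : ℝ) : EReal)) Set.univ z) :
    p + c • (x - z) ∈ subdiff g z := by
  have h0 : (0 : Vec n) ∈ subdiff (augObjective g (-p) x c) z := by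
    intro y
    have := isMinOn_iff.1 h y (Set.mem_univ y)
    simpa [augObjective, inner_neg_left, norm_sub_rev _ x] using this
  have := sub_mem_subdiff_of_mem_subdiff_augObjective hg h0
  have e : (0 : Vec n) - -p - c • (z - x) = p + c • (x - z) := by
    rw [← neg_sub x z, smul_neg]; abel
  rwa [e] at this

lemma subdiff_closed {f : Vec n → EReal} (hf : IsProperConvexLsc f) {x u : ℕ → Vec n}
    {xs us : Vec n} (hx : Tendsto x atTop (𝓝 xs)) (hu : Tendsto u atTop (𝓝 us))
    (h : ∀ᶠ k in atTop, u k ∈ subdiff f (x k)) : us ∈ subdiff f xs := by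
  intro y
  by_cases hy : f y = ⊤
  · rw [hy]; exact le_top
  obtain ⟨b, hb⟩ : ∃ b : ℝ, f y = (b : EReal) :=
    ⟨(f y).toReal, (EReal.coe_toReal hy (hf.ne_bot y)).symm⟩
  have hle : f xs ≤ ((b - inner ℝ us (y - xs) : ℝ) : EReal) := by
    -- A real `m` strictly between the two sides is eventually exceeded by `f (x k)`, by
    -- semicontinuity, while the subgradient inequality at `y` eventually keeps `f (x k)` below `m`.
    by_contra! hlt
    obtain ⟨m, hm1, hm2⟩ := EReal.lt_iff_exists_real_btwn.1 hlt
    have hlim : Tendsto (fun k => b - inner ℝ (u k) (y - x k)) atTop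
        (𝓝 (b - inner ℝ us (y - xs))) :=
      tendsto_const_nhds.sub (hu.inner (tendsto_const_nhds.sub hx))
    have h1 := hlim.eventually_lt_const (EReal.coe_lt_coe_iff.1 hm1)
    have h2 := hx.eventually (hf.lsc xs m hm2)
    obtain ⟨k, hk, hk1, hk2⟩ := (h.and (h1.and h2)).exists
    obtain ⟨a, ha⟩ := hf.exists_coe_of_mem_subdiff hk
    have h3 := hk y
    rw [ha, hb, ← EReal.coe_add, EReal.coe_le_coe_iff] at h3
    rw [ha, gt_iff_lt, EReal.coe_lt_coe_iff] at hk2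
    linarith
  calc f xs + ((inner ℝ us (y - xs) : ℝ) : EReal)
      ≤ ((b - inner ℝ us (y - xs) : ℝ) : EReal) + ((inner ℝ us (y - xs) : ℝ) : EReal) :=
        add_le_add_left hle _
    _ = f y := by rw [← EReal.coe_add, hb]; simp

/-- The resolvent of `∂f` is Lipschitz: `u = c x - p` with `-p ∈ ∂f(x)` determines `x`. -/
lemma mul_norm_sub_le_of_neg_mem_subdiff {f : Vec n → EReal} (hf : IsProperConvexLsc f)
    {x x' p p' : Vec n} (c : ℝ) (h : -p ∈ subdiff f x) (h' : -p' ∈ subdiff f x') :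
    c * ‖x - x'‖ ≤ ‖(c • x - p) - (c • x' - p')‖ := by
  have h0 := subdiff_monotone hf h h'
  have e : (c • x - p) - (c • x' - p') = c • (x - x') + (-p - -p') := by rw [smul_sub]; abel
  have h1 : inner ℝ (x - x') ((c • x - p) - (c • x' - p'))
      = c * ‖x - x'‖ ^ 2 + inner ℝ (x - x') (-p - -p') := by
    rw [e, inner_add_right, inner_smul_right, real_inner_self_eq_norm_sq]
  have h2 := real_inner_le_norm (x - x') ((c • x - p) - (c • x' - p'))
  rcases (norm_nonneg (x - x')).eq_or_lt with h3 | h3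
  · rw [← h3, mul_zero]; exact norm_nonneg _
  · refine le_of_mul_le_mul_left ?_ h3
    nlinarith

/-- `(x, p)` is a Kuhn–Tucker pair: `-p ∈ ∂f(x)` and `p ∈ ∂g(x)`. -/
def IsKT (f g : Vec n → EReal) (x p : Vec n) : Prop := -p ∈ subdiff f x ∧ p ∈ subdiff g x

lemma IsKT.isSolution {f g : Vec n → EReal} {x p : Vec n} (h : IsKT f g x p) :
    IsSolution f g x :=
  Set.mem_add.2 ⟨-p, h.1, p, h.2, neg_add_cancel p⟩

lemma IsSolution.exists_isKT {f g : Vec n → EReal} {x : Vec n} (h : IsSolution f g x) :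
    ∃ p, IsKT f g x p := by
  obtain ⟨a, ha, b, hb, hab⟩ := Set.mem_add.1 h
  refine ⟨b, ?_, hb⟩
  rwa [← eq_neg_of_add_eq_zero_left hab]

/-- The separating hyperplane: `c x' - p'` and `c z - p` are separated by `x - z`. -/
lemma IsKT.inner_nonpos {f g : Vec n → EReal} (hf : IsProperConvexLsc f)
    (hg : IsProperConvexLsc g) {x z p x' p' : Vec n} {c : ℝ} (h' : IsKT f g x' p')
    (hx : -p ∈ subdiff f x) (hz : p + c • (x - z) ∈ subdiff g z) :
    inner ℝ ((c • x' - p') - (c • z - p)) (x - z) ≤ 0 := by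
  have h1 := subdiff_monotone hf hx h'.1
  have h2 := subdiff_monotone hg hz h'.2
  simp only [inner_sub_left, inner_sub_right, inner_add_right, inner_smul_left, inner_smul_right,
    inner_neg_right, conj_trivial, real_inner_comm x p,
    real_inner_comm x p', real_inner_comm z p, real_inner_comm z p',
    real_inner_comm x z, real_inner_comm x x', real_inner_comm z x'] at h1 h2 ⊢
  linarith

/-- A bounded-resolvent limit argument: if `c x - p → w` and `x - z → 0`, then all three
sequences converge to a Kuhn–Tucker pair representing `w`. -/
lemma exists_isKT_of_tendsto {f g : Vec n → EReal} (hf : IsProperConvexLsc f)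
    (hg : IsProperConvexLsc g) {x' p' : Vec n} (h' : -p' ∈ subdiff f x') {c : ℝ} (hc : 0 < c)
    {x z p : ℕ → Vec n} {w : Vec n}
    (hx : ∀ᶠ k in atTop, -p k ∈ subdiff f (x k))
    (hz : ∀ᶠ k in atTop, p k + c • (x k - z k) ∈ subdiff g (z k))
    (hw : Tendsto (fun k => c • x k - p k) atTop (𝓝 w))
    (hxz : Tendsto (fun k => x k - z k) atTop (𝓝 0)) :
    ∃ xs ps, IsKT f g xs ps ∧ c • xs - ps = w ∧ Tendsto x atTop (𝓝 xs) ∧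
      Tendsto z atTop (𝓝 xs) ∧ Tendsto p atTop (𝓝 ps) := by
  obtain ⟨R, hR⟩ : ∃ R, ∀ᶠ k in atTop, x k ∈ Metric.closedBall x' R := by
    have h1 := (hw.sub_const (c • x' - p')).norm
    refine ⟨(‖w - (c • x' - p')‖ + 1) / c, ?_⟩
    filter_upwards [hx, h1.eventually_le_const (lt_add_one _)] with k hk hk1
    rw [mem_closedBall_iff_norm, le_div_iff₀ hc, mul_comm]
    exact (mul_norm_sub_le_of_neg_mem_subdiff hf c hk h').trans hk1
  obtain ⟨xs, -, φ, hφ, hlim⟩ :=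
    (isCompact_closedBall x' R).tendsto_subseq' hR.frequently
  have hφt := hφ.tendsto_atTop
  have hp : Tendsto (p ∘ φ) atTop (𝓝 (c • xs - w)) := by
    refine ((hlim.const_smul c).sub (hw.comp hφt)).congr fun k => ?_
    simp
  have hzl : Tendsto (z ∘ φ) atTop (𝓝 xs) := by
    have := hlim.sub (hxz.comp hφt)
    rw [sub_zero] at this
    exact this.congr fun k => by simp
  have hKT : IsKT f g xs (c • xs - w) := by
    refine ⟨subdiff_closed hf hlim hp.neg (hφt.eventually hx), ?_⟩
    have h2 := hp.add ((hxz.comp hφt).const_smul c)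
    rw [smul_zero, add_zero] at h2
    exact subdiff_closed hg hzl h2 (hφt.eventually hz)
  -- The cluster point satisfies `c xs - ps = w`, so the Lipschitz bound against it upgrades
  -- subsequential to full convergence.
  have hxl : Tendsto x atTop (𝓝 xs) := by
    rw [tendsto_iff_norm_sub_tendsto_zero]
    have h1 := (tendsto_iff_norm_sub_tendsto_zero.1 hw).div_const c
    rw [zero_div] at h1
    refine squeeze_zero' (Eventually.of_forall fun _ => norm_nonneg _) ?_ h1
    filter_upwards [hx] with k hk
    rw [le_div_iff₀ hc, mul_comm]
    have := mul_norm_sub_le_of_neg_mem_subdiff hf c hk hKT.1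
    rwa [sub_sub_cancel] at this
  refine ⟨xs, c • xs - w, hKT, sub_sub_cancel _ _, hxl, ?_, ?_⟩
  · have := hxl.sub hxz
    rw [sub_zero] at this
    exact this.congr fun k => by simp
  · exact ((hxl.const_smul c).sub hw).congr fun k => by simp

/-! ### Inertial relaxed Fejér sequences -/

lemma norm_extrapolate_sub_sq (a : ℕ → ℝ) (w : ℕ → Vec n) (ws : Vec n) (k : ℕ) :
    ‖extrapolate a w k - ws‖ ^ 2 = (1 + a k) * ‖w k - ws‖ ^ 2 - a k * ‖prevIterate w k - ws‖ ^ 2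
      + a k * (1 + a k) * ‖w k - prevIterate w k‖ ^ 2 := by
  have e1 : extrapolate a w k - ws
      = (w k - ws) + a k • ((w k - ws) - (prevIterate w k - ws)) := by
    simp [extrapolate]; abel
  have e2 : w k - prevIterate w k = (w k - ws) - (prevIterate w k - ws) := by abel
  rw [e1, e2]
  generalize w k - ws = u
  generalize prevIterate w k - ws = v
  rw [norm_add_sq_real, norm_smul, mul_pow, Real.norm_eq_abs, sq_abs, inner_smul_right,
    norm_sub_sq_real, inner_sub_right, real_inner_self_eq_norm_sq]
  ring

/-- This is `2⟨u, v⟩ ≤ ‖u‖² + ‖v‖²` applied to the cross term of two successive increments. -/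
lemma norm_sub_extrapolate_sq_ge (a : ℕ → ℝ) (w : ℕ → Vec n) {k : ℕ} (h0 : 0 ≤ a k) :
    (1 - a k) * ‖w (k + 1) - w k‖ ^ 2 - a k * (1 - a k) * ‖w k - prevIterate w k‖ ^ 2
      ≤ ‖w (k + 1) - extrapolate a w k‖ ^ 2 := by
  have e1 : w (k + 1) - extrapolate a w k
      = (w (k + 1) - w k) - a k • (w k - prevIterate w k) := by
    simp [extrapolate]; abel
  rw [e1]
  generalize w (k + 1) - w k = u
  generalize w k - prevIterate w k = v
  have h1 : 0 ≤ ‖u - v‖ ^ 2 := sq_nonneg _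
  rw [norm_sub_sq_real] at h1
  rw [norm_sub_sq_real, norm_smul, mul_pow, Real.norm_eq_abs, sq_abs, inner_smul_right]
  nlinarith [mul_nonneg h0 h1]

/-- Alvarez–Attouch type analysis of inertial relaxed Fejér monotone sequences. -/
lemma inertial_fejer {w : ℕ → Vec n} {ws : Vec n} {a : ℕ → ℝ} {α τ : ℝ}
    (ha : ∀ k, 0 ≤ a k) (hmono : Monotone a) (haα : ∀ k, a k ≤ α) (hα : α < 1)
    (hτ0 : 0 ≤ τ) (hτ : α * (1 + α) < τ * (1 - α) ^ 2)
    (h : ∀ k, ‖w (k + 1) - ws‖ ^ 2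
      ≤ ‖extrapolate a w k - ws‖ ^ 2 - τ * ‖w (k + 1) - extrapolate a w k‖ ^ 2) :
    (∃ L, Tendsto (fun k => ‖w k - ws‖ ^ 2) atTop (𝓝 L)) ∧
      Tendsto (fun k => w (k + 1) - w k) atTop (𝓝 0) := by
  have hα0 : 0 ≤ α := (ha 0).trans (haα 0)
  set φ : ℕ → ℝ := fun k => ‖w k - ws‖ ^ 2 with hφ
  set ψ : ℕ → ℝ := fun k => ‖prevIterate w k - ws‖ ^ 2 with hψ
  set δ : ℕ → ℝ := fun k => ‖w k - prevIterate w k‖ ^ 2 with hδ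
  -- `γ` collects the coefficients of `δ k` from the two extrapolation estimates; `μ` is the
  -- Lyapunov quantity, and `ε` its guaranteed decrease per unit of `δ (k + 1)`.
  set γ : ℕ → ℝ := fun k => a k * (1 + a k) + τ * (a k * (1 - a k)) with hγ
  set μ : ℕ → ℝ := fun k => φ k - a k * ψ k + γ k * δ k with hμ
  set ε : ℝ := τ * (1 - α) ^ 2 - α * (1 + α) with hε
  have hεpos : 0 < ε := sub_pos.2 hτ
  have hφ0 : ∀ k, 0 ≤ φ k := fun k => sq_nonneg _
  have hψ0 : ∀ k, 0 ≤ ψ k := fun k => sq_nonneg _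
  have hδ0 : ∀ k, 0 ≤ δ k := fun k => sq_nonneg _
  have hγ0 : ∀ k, 0 ≤ γ k := fun k => by
    have := ha k
    have : 0 ≤ 1 - a k := by linarith [haα k]
    positivity
  have hψs : ∀ k, ψ (k + 1) = φ k := fun k => rfl
  have hδs : ∀ k, δ (k + 1) = ‖w (k + 1) - w k‖ ^ 2 := fun k => rfl
  have hdec : ∀ k, ε * δ (k + 1) ≤ μ k - μ (k + 1) := by
    intro k
    have h1 := h k
    have h2 := norm_extrapolate_sub_sq a w ws k
    have h3 := mul_le_mul_of_nonneg_left (norm_sub_extrapolate_sq_ge a w (ha k)) hτ0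
    have h4 : φ (k + 1) ≤ (1 + a k) * φ k - a k * ψ k + γ k * δ k
        - τ * (1 - a k) * δ (k + 1) := by
      simp only [hδs, hγ]
      simp only [hφ, hψ, hδ]
      linarith
    -- Monotone inertia lets `a k` be replaced by `a (k + 1)`, both in the term `a k * φ k` and in
    -- `τ (1 - a k)`; the latter then combines with `γ (k + 1)` into `τ (1 - a (k + 1))²`.
    have h5 : a k ≤ a (k + 1) := hmono k.le_succ
    have h6 : ε ≤ τ * (1 - a k) - γ (k + 1) := by
      have hb := haα (k + 1)
      have hb0 := ha (k + 1)
      simp only [hε, hγ]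
      have i1 : (1 - α) ^ 2 ≤ (1 - a (k + 1)) ^ 2 := by nlinarith
      have i2 : a (k + 1) * (1 + a (k + 1)) ≤ α * (1 + α) := by nlinarith
      have i3 := mul_le_mul_of_nonneg_left i1 hτ0
      have i4 := mul_le_mul_of_nonneg_left h5 hτ0
      linarith
    have h7 := mul_le_mul_of_nonneg_right h6 (hδ0 (k + 1))
    have h8 := mul_le_mul_of_nonneg_right h5 (hφ0 k)
    simp only [hμ, hψs]
    linarith
  have hanti : Antitone μ := antitone_nat_of_succ_le fun k => by
    linarith [hdec k, mul_nonneg hεpos.le (hδ0 (k + 1))]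
  have hμ0 : μ 0 ≤ φ 0 := by
    have : δ 0 = 0 := by simp [hδ, prevIterate]
    simp only [hμ, this]
    linarith [mul_nonneg (ha 0) (hψ0 0)]
  -- The fixed point of `s ↦ α s + φ 0`, the recursion left when the `γ δ` term is dropped from `μ
  -- (k + 1) ≤ φ 0`.
  set M := φ 0 / (1 - α) with hM
  have h1α : 0 < 1 - α := by linarith
  have hMeq : α * M + φ 0 = M := by rw [hM]; field_simp; ring
  have hM0 : 0 ≤ M := div_nonneg (hφ0 0) h1α.le
  have hbd : ∀ k, φ k ≤ M := by
    intro k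
    induction k with
    | zero => linarith [mul_nonneg hα0 hM0]
    | succ k ih =>
      have h1 : μ (k + 1) ≤ φ 0 := (hanti (Nat.zero_le _)).trans hμ0
      simp only [hμ, hψs] at h1
      have h2 := mul_nonneg (hγ0 (k + 1)) (hδ0 (k + 1))
      have h3 : a (k + 1) * φ k ≤ α * M := mul_le_mul (haα _) ih (hφ0 k) hα0
      linarith
  have hμbd : BddBelow (Set.range μ) := by
    refine ⟨-(α * M), ?_⟩
    rintro _ ⟨k, rfl⟩
    have h1 : a k * ψ k ≤ α * M := by
      refine mul_le_mul (haα _) ?_ (hψ0 k) hα0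
      cases k with
      | zero => exact hbd 0
      | succ k => exact hbd k
    simp only [hμ]
    linarith [hφ0 k, mul_nonneg (hγ0 k) (hδ0 k)]
  have hμlim := tendsto_atTop_ciInf hanti hμbd
  set m := ⨅ k, μ k
  have hδlim : Tendsto (fun k => δ (k + 1)) atTop (𝓝 0) := by
    have h1 := (hμlim.sub (hμlim.comp (tendsto_add_atTop_nat 1))).div_const ε
    rw [sub_self, zero_div] at h1
    refine squeeze_zero (fun k => hδ0 _) (fun k => ?_) h1
    rw [le_div_iff₀ hεpos, mul_comm]
    exact hdec k
  have hnorm : Tendsto (fun k => ‖w (k + 1) - w k‖) atTop (𝓝 0) := by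
    have := hδlim.sqrt
    rw [Real.sqrt_zero] at this
    refine this.congr fun k => ?_
    rw [hδs, Real.sqrt_sq (norm_nonneg _)]
  refine ⟨?_, tendsto_zero_iff_norm_tendsto_zero.2 hnorm⟩
  have hdiff : Tendsto (fun k => φ (k + 1) - φ k) atTop (𝓝 0) := by
    refine squeeze_zero_norm (a := fun k => ‖w (k + 1) - w k‖ * (2 * √M)) (fun k => ?_) ?_
    · have hs : ∀ k, ‖w k - ws‖ ≤ √M := fun k => Real.le_sqrt_of_sq_le (hbd k)
      have e : φ (k + 1) - φ k
          = (‖w (k + 1) - ws‖ - ‖w k - ws‖) * (‖w (k + 1) - ws‖ + ‖w k - ws‖) := by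
        simp only [hφ]; ring
      rw [e, norm_mul, Real.norm_eq_abs, Real.norm_eq_abs]
      have h1 := abs_norm_sub_norm_le (w (k + 1) - ws) (w k - ws)
      rw [sub_sub_sub_cancel_right] at h1
      refine mul_le_mul h1 ?_ (abs_nonneg _) (norm_nonneg _)
      rw [abs_of_nonneg (by positivity)]
      linarith [hs k, hs (k + 1)]
    · simpa using hnorm.mul_const (2 * √M)
  have halim : Tendsto a atTop (𝓝 (⨆ k, a k)) :=
    tendsto_atTop_ciSup hmono ⟨α, by rintro _ ⟨k, rfl⟩; exact haα k⟩
  set A := ⨆ k, a k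
  have hA : A ≤ α := ciSup_le haα
  -- Solve the definition of `μ` for `φ`: `(1 - a) φ (k + 1) = μ - a (φ (k + 1) - φ k) - γ δ`, with
  -- `a`, `μ`, `γ`, `δ` at `k + 1`. The last two terms vanish, and `a` converges, being monotone and
  -- bounded.
  have hφs : Tendsto (fun k => φ (k + 1)) atTop (𝓝 (m / (1 - A))) := by
    have ha1 := halim.comp (tendsto_add_atTop_nat 1)
    have hγlim : Tendsto (fun k => γ (k + 1)) atTop (𝓝 (A * (1 + A) + τ * (A * (1 - A)))) :=
      (ha1.mul (ha1.const_add 1)).add ((ha1.mul (ha1.const_sub 1)).const_mul τ)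
    have h1 := (((hμlim.comp (tendsto_add_atTop_nat 1)).sub (ha1.mul hdiff)).sub
      (hγlim.mul hδlim)).div (ha1.const_sub 1) (by linarith)
    rw [mul_zero, mul_zero, sub_zero, sub_zero] at h1
    refine h1.congr fun k => ?_
    have : 1 - a (k + 1) ≠ 0 := by linarith [haα (k + 1)]
    simp only [Function.comp_apply, hμ, hψs, Pi.div_apply]
    rw [div_eq_iff this]
    ring
  exact ⟨_, (tendsto_add_atTop_iff_nat 1).1 hφs⟩

/-- A relaxed projection onto a separating half-space. -/
lemma norm_relaxed_projection_sub_sq_le {w ws r u : Vec n} {ρ θ τ : ℝ} (hρ : 0 ≤ ρ)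
    (hτ : τ * ρ ≤ 2 - ρ) (hθ0 : 0 ≤ θ) (hθ : θ * ‖u‖ ^ 2 = inner ℝ r u)
    (hsep : inner ℝ (ws - (w - r)) u ≤ 0) :
    ‖w - (ρ * θ) • u - ws‖ ^ 2 ≤ ‖w - ws‖ ^ 2 - τ * ‖w - (ρ * θ) • u - w‖ ^ 2 := by
  have e1 : w - (ρ * θ) • u - ws = (w - ws) - (ρ * θ) • u := by abel
  have e2 : w - (ρ * θ) • u - w = -((ρ * θ) • u) := by abel
  have e3 : inner ℝ (ws - (w - r)) u = inner ℝ r u - inner ℝ (w - ws) u := by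
    rw [← inner_sub_left]; congr 1; abel
  rw [e3] at hsep
  rw [e1, e2, norm_neg, norm_sub_sq_real, inner_smul_right, norm_smul, mul_pow, Real.norm_eq_abs,
    sq_abs]
  -- Separation gives `⟨w - ws, u⟩ ≥ θ ‖u‖²`, so the squared distance drops by at least `ρ (2 - ρ)
  -- θ² ‖u‖²`, which is at least `τ ρ² θ² ‖u‖²`.
  have h1 := mul_nonneg (mul_nonneg hρ hθ0) (sub_nonneg.2 (sub_nonpos.1 hsep))
  have h2 := mul_nonneg (mul_nonneg (mul_nonneg hρ (sq_nonneg θ)) (sq_nonneg ‖u‖))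
    (sub_nonneg.2 hτ)
  have h3 : ρ * θ * (θ * ‖u‖ ^ 2) = ρ * θ * inner ℝ r u := by rw [hθ]
  nlinarith

/-! ### The relative error criterion -/

/-- Polarization: `‖y‖² = ‖u‖² - 2⟨r, u⟩ + ‖r‖²`. -/
lemma inner_ge_of_relative_error {r u y : Vec n} {σ : ℝ} (hr : r = u - y)
    (h : ‖y‖ ^ 2 ≤ σ ^ 2 * (‖r‖ ^ 2 + ‖u‖ ^ 2)) :
    (1 - σ ^ 2) / 2 * (‖r‖ ^ 2 + ‖u‖ ^ 2) ≤ inner ℝ r u := by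
  have hy : y = u - r := by rw [hr, sub_sub_cancel]
  rw [hy, norm_sub_sq_real, real_inner_comm] at h
  linarith

/-! ### Inner iterations: subgradients, residuals, and the two finite outcomes -/

namespace Trace

variable {t : Trace n} {P : Params} {f g : Vec n → EReal}
  {F : Vec n → Vec n → ℝ → Vec n → ℕ → Vec n × Vec n} {k l : ℕ}

lemma InnerStep.neg_mem_subdiff (h : t.InnerStep P g F k l) (hf : IsProperConvexLsc f)
    (hF : IsFProcedure f F) (hl : 1 ≤ l) : -t.pi k l ∈ subdiff f (t.xi k l) := by
  have h1 := (hF (t.pHat k) (t.zHat k) (t.xHat k) P.c P.c_pos).2 l hl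
  rw [← h.xy_eq] at h1
  have h2 := sub_mem_subdiff_of_mem_subdiff_augObjective hf h1
  have e : t.yi k l - t.pHat k - P.c • (t.xi k l - t.zHat k) = -t.pi k l := by
    rw [h.p_eq]; abel
  rwa [e] at h2

lemma InnerStep.mem_subdiff (h : t.InnerStep P g F k l) (hg : IsProperConvexLsc g) :
    t.pi k l + P.c • (t.xi k l - t.zi k l) ∈ subdiff g (t.zi k l) :=
  mem_subdiff_of_isMinOn hg h.z_argmin

lemma InnerStep.residual_eq (h : t.InnerStep P g F k l) :
    t.pi k l - t.pHat k - P.c • (t.zi k l - t.zHat k)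
      = P.c • (t.xi k l - t.zi k l) - t.yi k l := by
  rw [h.p_eq]; simp only [smul_sub]; abel

lemma norm_gap_sq : ‖P.c • (t.xi k l - t.zi k l)‖ ^ 2 = P.c ^ 2 * ‖t.xi k l - t.zi k l‖ ^ 2 := by
  rw [norm_smul, mul_pow, Real.norm_eq_abs, sq_abs]

lemma one_sub_sq_pos (P : Params) : 0 < (1 - P.σ ^ 2) / 2 := by
  nlinarith [P.σ_nonneg, P.σ_lt_one]

lemma InnerStep.inner_ge (h : t.InnerStep P g F k l) (hA : t.Accepts P k l) :
    (1 - P.σ ^ 2) / 2 * (‖t.pi k l - t.pHat k - P.c • (t.zi k l - t.zHat k)‖ ^ 2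
      + ‖P.c • (t.xi k l - t.zi k l)‖ ^ 2)
      ≤ inner ℝ (t.pi k l - t.pHat k - P.c • (t.zi k l - t.zHat k))
        (P.c • (t.xi k l - t.zi k l)) :=
  inner_ge_of_relative_error h.residual_eq (by rw [norm_gap_sq]; exact hA)

/-- If `r = 0`, the lower bound on `⟨r, u⟩` forces `u = 0`; once `x = z`, the subgradients of `f`
and `g` at this point are `-p` and `p`. -/
lemma StopsAt.eq_and_isSolution (h : t.StopsAt P g F k l) (hf : IsProperConvexLsc f)
    (hg : IsProperConvexLsc g) (hF : IsFProcedure f F) :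
    t.xi k l = t.zi k l ∧ IsSolution f g (t.xi k l) := by
  have hs := h.inner_ends.steps l h.inner_ends.one_le le_rfl
  have h1 := hs.inner_ge h.inner_ends.accepted
  have hpos := one_sub_sq_pos P
  have heq : t.xi k l = t.zi k l := by
    rcases h.halts with h2 | h2
    · rw [sub_eq_zero.2 h2, inner_zero_left, norm_zero] at h1
      have h3 : ‖P.c • (t.xi k l - t.zi k l)‖ = 0 := by
        have h4 := nonpos_of_mul_nonpos_right h1 hpos
        exact pow_eq_zero_iff two_ne_zero |>.1 (le_antisymm (by linarith) (sq_nonneg _))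
      rw [norm_eq_zero, smul_eq_zero, sub_eq_zero] at h3
      exact h3.resolve_left P.c_pos.ne'
    · exact h2
  refine ⟨heq, IsKT.isSolution (p := t.pi k l)
    ⟨hs.neg_mem_subdiff hf hF h.inner_ends.one_le, ?_⟩⟩
  have := hs.mem_subdiff hg
  rw [← heq, sub_self, smul_zero, add_zero] at this
  exact this

lemma InnerRunsForever.converges (h : t.InnerRunsForever P g F k) (hσ : 0 < P.σ)
    (hf : IsProperConvexLsc f) (hg : IsProperConvexLsc g) (hsol : ∃ x, IsSolution f g x)
    (hF : IsFProcedure f F) :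
    ∃ xs ps, IsKT f g xs ps ∧ Tendsto (t.xi k) atTop (𝓝 xs) ∧
      Tendsto (t.zi k) atTop (𝓝 xs) ∧ Tendsto (t.pi k) atTop (𝓝 ps) := by
  obtain ⟨x', h'⟩ := hsol
  obtain ⟨p', h'⟩ := h'.exists_isKT
  have hev : ∀ᶠ l in atTop, 1 ≤ l := eventually_ge_atTop 1
  have hy : Tendsto (t.yi k) atTop (𝓝 0) := by
    refine (hF (t.pHat k) (t.zHat k) (t.xHat k) P.c P.c_pos).1.congr' ?_
    filter_upwards [hev] with l hl
    rw [← (h.steps l hl).xy_eq]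
  have hxz : Tendsto (fun l => t.xi k l - t.zi k l) atTop (𝓝 0) := by
    have h1 := hy.norm.div_const (P.σ * P.c)
    rw [norm_zero, zero_div] at h1
    refine squeeze_zero_norm' ?_ h1
    filter_upwards [hev] with l hl
    -- Rejection means `σ c ‖x - z‖ < ‖y‖` once the `r` term is discarded; dividing requires `σ >
    -- 0`.
    have h2 := not_le.1 (h.rejected l hl)
    have hσc : 0 < P.σ * P.c := mul_pos hσ P.c_pos
    rw [le_div_iff₀ hσc]
    refine le_of_sq_le_sq ?_ (norm_nonneg _)
    have h3 := mul_nonneg (sq_nonneg P.σ)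
      (sq_nonneg ‖t.pi k l - t.pHat k - P.c • (t.zi k l - t.zHat k)‖)
    nlinarith
  have hw : Tendsto (fun l => P.c • t.xi k l - t.pi k l) atTop
      (𝓝 (P.c • t.zHat k - t.pHat k)) := by
    have h1 := hy.const_add (P.c • t.zHat k - t.pHat k)
    rw [add_zero] at h1
    refine h1.congr' ?_
    filter_upwards [hev] with l hl
    rw [(h.steps l hl).p_eq, smul_sub]; abel
  obtain ⟨xs, ps, h1, -, h2⟩ := exists_isKT_of_tendsto hf hg h'.1 P.c_pos
    (hev.mono fun l hl => (h.steps l hl).neg_mem_subdiff hf hF hl)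
    (hev.mono fun l hl => (h.steps l hl).mem_subdiff hg) hw hxz
  exact ⟨xs, ps, h1, h2⟩

/-! ### Outer iterations as relaxed projections -/

/-- The Douglas–Rachford variable `c z^k - p^k`. -/
def drVar (t : Trace n) (P : Params) (k : ℕ) : Vec n := P.c • t.z k - t.p k

lemma extrapolate_drVar (t : Trace n) (P : Params) (k : ℕ) :
    extrapolate t.α (t.drVar P) k = P.c • t.zHat k - t.pHat k := by
  have : prevIterate (t.drVar P) k = P.c • prevIterate t.z k - prevIterate t.p k := by
    cases k <;> rfl
  simp only [zHat, pHat, extrapolate, this, drVar, smul_sub, smul_add, smul_comm P.c (t.α k)]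
  abel

/-- Identifies `θ` as `⟨r, u⟩ / ‖u‖²`, the coefficient of the projection onto the separating
half-space. -/
lemma theta_mul_norm_sq (hne : t.xi k l ≠ t.zi k l) :
    t.theta P k l * ‖P.c • (t.xi k l - t.zi k l)‖ ^ 2
      = inner ℝ (t.pi k l - t.pHat k - P.c • (t.zi k l - t.zHat k))
        (P.c • (t.xi k l - t.zi k l)) := by
  have h1 : ‖t.xi k l - t.zi k l‖ ≠ 0 := norm_ne_zero_iff.2 (sub_ne_zero.2 hne)
  have hc := P.c_pos.ne'
  have e : t.pi k l - t.pHat k - P.c • (t.zi k l - t.zHat k)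
      = P.c • (t.zHat k - t.zi k l) - (t.pHat k - t.pi k l) := by
    simp only [smul_sub]; abel
  rw [e, theta, norm_gap_sq, inner_smul_right]
  field_simp

/-- The update of `p` is designed for this: in terms of `w` it is a move along `-u` alone. -/
lemma OuterStep.drVar_succ (h : t.OuterStep P g F k l) :
    t.drVar P (k + 1) = extrapolate t.α (t.drVar P) k
      - (t.ρ k * t.theta P k l) • (P.c • (t.xi k l - t.zi k l)) := by
  rw [extrapolate_drVar, drVar, h.p_next, h.x_next, h.z_next]
  simp only [smul_sub, smul_add, sub_smul, one_smul,
    smul_comm (t.ρ k * t.theta P k l) P.c]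
  abel

lemma OuterStep.theta_ge (h : t.OuterStep P g F k l) : (1 - P.σ ^ 2) / 2 ≤ t.theta P k l := by
  have hs := h.inner_ends.steps l h.inner_ends.one_le le_rfl
  have h1 := hs.inner_ge h.inner_ends.accepted
  rw [← theta_mul_norm_sq (OuterStep.not_stop h)] at h1
  have hu : 0 < ‖P.c • (t.xi k l - t.zi k l)‖ ^ 2 := by
    rw [norm_gap_sq]
    have := norm_pos_iff.2 (sub_ne_zero.2 (OuterStep.not_stop h))
    have := P.c_pos
    positivity
  refine le_of_mul_le_mul_right ?_ hu
  nlinarith [mul_nonneg (one_sub_sq_pos P).le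
    (sq_nonneg ‖t.pi k l - t.pHat k - P.c • (t.zi k l - t.zHat k)‖)]

lemma OuterStep.fejer (h : t.OuterStep P g F k l) (hf : IsProperConvexLsc f)
    (hg : IsProperConvexLsc g) (hF : IsFProcedure f F) {x' p' : Vec n} (h' : IsKT f g x' p') :
    ‖t.drVar P (k + 1) - (P.c • x' - p')‖ ^ 2
      ≤ ‖extrapolate t.α (t.drVar P) k - (P.c • x' - p')‖ ^ 2
        - (2 / P.ρhi - 1) * ‖t.drVar P (k + 1) - extrapolate t.α (t.drVar P) k‖ ^ 2 := by
  have hs := h.inner_ends.steps l h.inner_ends.one_le le_rfl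
  have hlo := P.ρlo_pos.trans_le h.ρ_mem.1
  have hhi : 0 < P.ρhi := P.ρlo_pos.trans P.ρlo_lt_ρhi
  rw [h.drVar_succ]
  refine norm_relaxed_projection_sub_sq_le
    (r := t.pi k l - t.pHat k - P.c • (t.zi k l - t.zHat k)) hlo.le ?_
    ((one_sub_sq_pos P).le.trans h.theta_ge) (theta_mul_norm_sq (OuterStep.not_stop h)) ?_
  · have : 2 / P.ρhi * t.ρ k ≤ 2 := by
      rw [div_mul_eq_mul_div, div_le_iff₀ hhi]
      linarith [h.ρ_mem.2]
    linarith
  · have h1 := h'.inner_nonpos hf hg (hs.neg_mem_subdiff hf hF h.inner_ends.one_le)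
      (hs.mem_subdiff hg)
    have e : extrapolate t.α (t.drVar P) k
        - (t.pi k l - t.pHat k - P.c • (t.zi k l - t.zHat k)) = P.c • t.zi k l - t.pi k l := by
      rw [extrapolate_drVar]; simp only [smul_sub]; abel
    rw [e, inner_smul_right]
    exact mul_nonpos_of_nonneg_of_nonpos P.c_pos.le h1

/-- Both residuals of an outer step are controlled by its length. -/
lemma OuterStep.residuals_le (h : t.OuterStep P g F k l) :
    P.ρlo * ((1 - P.σ ^ 2) / 2) * ‖P.c • (t.xi k l - t.zi k l)‖
      ≤ ‖t.drVar P (k + 1) - extrapolate t.α (t.drVar P) k‖ ∧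
    P.ρlo * ((1 - P.σ ^ 2) / 2) * ‖t.pi k l - t.pHat k - P.c • (t.zi k l - t.zHat k)‖
      ≤ ‖t.drVar P (k + 1) - extrapolate t.α (t.drVar P) k‖ := by
  have hs := h.inner_ends.steps l h.inner_ends.one_le le_rfl
  have h1 := hs.inner_ge h.inner_ends.accepted
  rw [← theta_mul_norm_sq (OuterStep.not_stop h)] at h1
  have hpos := one_sub_sq_pos P
  have hθ := h.theta_ge
  have hu : 0 < ‖P.c • (t.xi k l - t.zi k l)‖ :=
    norm_pos_iff.2 (smul_ne_zero P.c_pos.ne' (sub_ne_zero.2 (OuterStep.not_stop h)))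
  have hlen : ‖t.drVar P (k + 1) - extrapolate t.α (t.drVar P) k‖
      = t.ρ k * (t.theta P k l * ‖P.c • (t.xi k l - t.zi k l)‖) := by
    have hρ0 := P.ρlo_pos.trans_le h.ρ_mem.1
    rw [h.drVar_succ, sub_sub_cancel_left, norm_neg, norm_smul, Real.norm_eq_abs,
      abs_of_nonneg (mul_nonneg hρ0.le (hpos.le.trans hθ)), mul_assoc]
  rw [hlen, mul_assoc, mul_assoc]
  generalize ‖P.c • (t.xi k l - t.zi k l)‖ = U at *
  generalize ‖t.pi k l - t.pHat k - P.c • (t.zi k l - t.zHat k)‖ = R at *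
  -- After multiplying by `U`, use `R U ≤ R² + U²` and the lower bound on `⟨r, u⟩ = θ U²`.
  have h2 : (1 - P.σ ^ 2) / 2 * R ≤ t.theta P k l * U := by
    refine le_of_mul_le_mul_right ?_ hu
    nlinarith [mul_nonneg hpos.le (sq_nonneg (R - U)),
      mul_nonneg hpos.le (add_nonneg (sq_nonneg R) (sq_nonneg U))]
  have h3 : (1 - P.σ ^ 2) / 2 * U ≤ t.theta P k l * U := mul_le_mul_of_nonneg_right hθ hu.le
  have h4 : 0 ≤ t.theta P k l * U := mul_nonneg (hpos.le.trans hθ) hu.le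
  exact ⟨(mul_le_mul_of_nonneg_left h3 P.ρlo_pos.le).trans
      (mul_le_mul_of_nonneg_right h.ρ_mem.1 h4),
    (mul_le_mul_of_nonneg_left h2 P.ρlo_pos.le).trans
      (mul_le_mul_of_nonneg_right h.ρ_mem.1 h4)⟩

lemma RunsForever.converges (h : t.RunsForever P g F) (hf : IsProperConvexLsc f)
    (hg : IsProperConvexLsc g) (hsol : ∃ x, IsSolution f g x) (hF : IsFProcedure f F)
    (hα : ∀ k, 0 ≤ t.α k ∧ t.α k ≤ t.α (k + 1) ∧ t.α (k + 1) ≤ P.α)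
    (hτ : P.α * (1 + P.α) < (2 / P.ρhi - 1) * (1 - P.α) ^ 2) :
    ∃ xs ps, IsKT f g xs ps ∧ Tendsto t.x atTop (𝓝 xs) ∧
      Tendsto t.z atTop (𝓝 xs) ∧ Tendsto t.p atTop (𝓝 ps) := by
  obtain ⟨l, hl⟩ := h
  obtain ⟨x', h'⟩ := hsol
  obtain ⟨p', h'⟩ := h'.exists_isKT
  have hstep : ∀ k, t.InnerStep P g F k (l k) := fun k =>
    (hl k).inner_ends.steps _ (hl k).inner_ends.one_le le_rfl
  have hhi : 0 < P.ρhi := P.ρlo_pos.trans P.ρlo_lt_ρhi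
  have hτ0 : 0 ≤ 2 / P.ρhi - 1 := by
    rw [sub_nonneg, le_div_iff₀ hhi]; linarith [P.ρhi_lt_two]
  have hfej : ∀ x p, IsKT f g x p →
      (∃ L, Tendsto (fun k => ‖t.drVar P k - (P.c • x - p)‖ ^ 2) atTop (𝓝 L)) ∧
      Tendsto (fun k => t.drVar P (k + 1) - t.drVar P k) atTop (𝓝 0) := fun x p hxp =>
    inertial_fejer (fun k => (hα k).1) (monotone_nat_of_le_succ fun k => (hα k).2.1)
      (fun k => (hα k).2.1.trans (hα k).2.2) P.α_lt_one hτ0 hτ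
      (fun k => (hl k).fejer hf hg hF hxp)
  obtain ⟨⟨L', hL'⟩, hd⟩ := hfej x' p' h'
  set w := t.drVar P with hw
  have hext : Tendsto (fun k => extrapolate t.α w k - w k) atTop (𝓝 0) := by
    rw [← tendsto_add_atTop_iff_nat 1]
    refine squeeze_zero_norm (fun k => ?_) (tendsto_zero_iff_norm_tendsto_zero.1 hd)
    have e : extrapolate t.α w (k + 1) - w (k + 1) = t.α (k + 1) • (w (k + 1) - w k) := by
      simp [extrapolate, prevIterate]
    rw [e, norm_smul, Real.norm_eq_abs, abs_of_nonneg (hα _).1]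
    exact mul_le_of_le_one_left (norm_nonneg _) ((hα k).2.2.trans P.α_lt_one.le)
  have hlen : Tendsto (fun k => ‖w (k + 1) - extrapolate t.α w k‖) atTop (𝓝 0) := by
    have := (hd.sub hext).norm
    rw [sub_zero, norm_zero] at this
    exact this.congr fun k => by simp
  have hκ : 0 < P.ρlo * ((1 - P.σ ^ 2) / 2) := mul_pos P.ρlo_pos (one_sub_sq_pos P)
  have hlen' := hlen.div_const (P.ρlo * ((1 - P.σ ^ 2) / 2))
  rw [zero_div] at hlen'
  have hu : Tendsto (fun k => P.c • (t.xi k (l k) - t.zi k (l k))) atTop (𝓝 0) := by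
    refine squeeze_zero_norm (fun k => ?_) hlen'
    rw [le_div_iff₀ hκ, mul_comm]
    exact (hl k).residuals_le.1
  have hr : Tendsto (fun k => t.pi k (l k) - t.pHat k - P.c • (t.zi k (l k) - t.zHat k)) atTop
      (𝓝 0) := by
    refine squeeze_zero_norm (fun k => ?_) hlen'
    rw [le_div_iff₀ hκ, mul_comm]
    exact (hl k).residuals_le.2
  have hxz : Tendsto (fun k => t.xi k (l k) - t.zi k (l k)) atTop (𝓝 0) := by
    have := hu.const_smul P.c⁻¹
    rw [smul_zero] at this
    exact this.congr fun k => inv_smul_smul₀ P.c_pos.ne' _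
  -- Here `c x - p = ŵ - r + u` with the inner multiplier `p^{k,ℓ}`, which in general differs from
  -- `p^{k+1}`.
  have hdr : Tendsto (fun k => (P.c • t.xi k (l k) - t.pi k (l k)) - w k) atTop (𝓝 0) := by
    have := (hext.sub hr).add hu
    rw [sub_zero, add_zero] at this
    refine this.congr fun k => ?_
    rw [hw, extrapolate_drVar]; simp only [smul_sub]; abel
  have hf1 : ∀ k, -t.pi k (l k) ∈ subdiff f (t.xi k (l k)) := fun k =>
    (hstep k).neg_mem_subdiff hf hF (hl k).inner_ends.one_le
  have hg1 := fun k => (hstep k).mem_subdiff hg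
  obtain ⟨R, hR⟩ : ∃ R, ∀ᶠ k in atTop, w k ∈ Metric.closedBall (P.c • x' - p') R := by
    refine ⟨√(L' + 1), ?_⟩
    filter_upwards [hL'.eventually_le_const (lt_add_one _)] with k hk
    rw [mem_closedBall_iff_norm]
    exact Real.le_sqrt_of_sq_le hk
  obtain ⟨ws, -, φ, hφ, hws⟩ :=
    (isCompact_closedBall (P.c • x' - p') R).tendsto_subseq' hR.frequently
  have hφt := hφ.tendsto_atTop
  -- Opial: the cluster point `ws` is itself of the form `c xs - ps`, so its distance to `w k`
  -- converges, and the limit is `0` along the subsequence.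
  have hwlim : Tendsto w atTop (𝓝 ws) := by
    have h1 := (hdr.comp hφt).add hws
    rw [zero_add] at h1
    obtain ⟨xs, ps, hKT, he, -⟩ := exists_isKT_of_tendsto hf hg h'.1 P.c_pos
      (x := fun j => t.xi (φ j) (l (φ j))) (z := fun j => t.zi (φ j) (l (φ j)))
      (p := fun j => t.pi (φ j) (l (φ j)))
      (Eventually.of_forall fun j => hf1 (φ j)) (Eventually.of_forall fun j => hg1 (φ j))
      (h1.congr fun j => by simp) (hxz.comp hφt)
    obtain ⟨L, hL⟩ := (hfej xs ps hKT).1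
    rw [he] at hL
    have h2 : Tendsto (fun j => ‖w (φ j) - ws‖ ^ 2) atTop (𝓝 0) := by
      have := ((tendsto_iff_norm_sub_tendsto_zero.1 hws).pow 2)
      rwa [zero_pow two_ne_zero] at this
    have hL0 : L = 0 := tendsto_nhds_unique (hL.comp hφt) h2
    rw [tendsto_iff_norm_sub_tendsto_zero]
    have h3 := hL.sqrt
    rw [hL0, Real.sqrt_zero] at h3
    exact h3.congr fun k => Real.sqrt_sq (norm_nonneg _)
  have h1 := hdr.add hwlim
  rw [zero_add] at h1
  obtain ⟨xs, ps, hKT, he, hx, hz, -⟩ := exists_isKT_of_tendsto hf hg h'.1 P.c_pos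
    (Eventually.of_forall hf1) (Eventually.of_forall hg1)
    (h1.congr fun k => by simp) hxz
  have hzlim : Tendsto t.z atTop (𝓝 xs) :=
    (tendsto_add_atTop_iff_nat 1).1 (hz.congr fun k => (hl k).z_next.symm)
  refine ⟨xs, ps, hKT,
    (tendsto_add_atTop_iff_nat 1).1 (hx.congr fun k => (hl k).x_next.symm), hzlim, ?_⟩
  -- The outer multiplier is recovered from `p = c z - w`.
  have h2 := (hzlim.const_smul P.c).sub hwlim
  rw [← he, sub_sub_cancel] at h2
  exact h2.congr fun k => by simp [hw, drVar]

end Trace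

/-! ### The parameter condition and the conclusion -/

lemma inertia_lt_relaxation {α β ρ : ℝ} (hα : 0 ≤ α) (hαβ : α < β) (hβ : β < 1)
    (hρ : ρ = 2 * (β - 1) ^ 2 / (2 * (β - 1) ^ 2 + 3 * β - 1)) :
    α * (1 + α) < (2 / ρ - 1) * (1 - α) ^ 2 := by
  have h1 : 0 < (β - 1) ^ 2 := by nlinarith
  -- The denominator equals `((4β - 1)² + 7) / 8`.
  have h2 : 0 < 2 * (β - 1) ^ 2 + 3 * β - 1 := by nlinarith [sq_nonneg (4 * β - 1)]
  -- Thus `ρ̄` is the value giving equality with `β` in place of `α`; strictness comes from `α < β`.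
  have h3 : 2 / ρ - 1 = β * (1 + β) / (β - 1) ^ 2 := by
    rw [hρ]
    have : β - 1 ≠ 0 := by linarith
    field_simp
    ring
  rw [h3, div_mul_eq_mul_div, lt_div_iff₀ h1]
  have h4 : α * (1 + α) < β * (1 + β) := by nlinarith
  have h5 : (β - 1) ^ 2 < (1 - α) ^ 2 := by nlinarith
  exact mul_lt_mul'' h4 h5 (by positivity) h1.le

end InertialADMM

theorem theorem4p3 (n : ℕ) (f g : InertialADMM.Vec n → EReal)
    (hf : InertialADMM.IsProperConvexLsc f) (hg : InertialADMM.IsProperConvexLsc g)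
    (hsol : ∃ x, InertialADMM.IsSolution f g x)
    (F : InertialADMM.Vec n → InertialADMM.Vec n → ℝ → InertialADMM.Vec n → ℕ →
      InertialADMM.Vec n × InertialADMM.Vec n)
    (hF : InertialADMM.IsFProcedure f F)
    (P : InertialADMM.Params) (t : InertialADMM.Trace n)
    (β : ℝ) (hαβ : P.α < β) (hβ : β < 1)
    (hα : ∀ k, 0 ≤ t.α k ∧ t.α k ≤ t.α (k + 1) ∧ t.α (k + 1) ≤ P.α)
    (hρ : P.ρhi = 2 * (β - 1) ^ 2 / (2 * (β - 1) ^ 2 + 3 * β - 1)) :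
    (t.RunsForever P g F →
      ∃ xs ps : InertialADMM.Vec n, InertialADMM.IsSolution f g xs ∧
        Tendsto t.x atTop (𝓝 xs) ∧ Tendsto t.z atTop (𝓝 xs) ∧ Tendsto t.p atTop (𝓝 ps) ∧
        ps ∈ InertialADMM.subdiff g xs ∧ -ps ∈ InertialADMM.subdiff f xs) ∧
    (∀ K, t.InnerRunsForever P g F K → 0 < P.σ →
      ∃ xs ps : InertialADMM.Vec n, InertialADMM.IsSolution f g xs ∧
        Tendsto (t.xi K) atTop (𝓝 xs) ∧ Tendsto (t.zi K) atTop (𝓝 xs) ∧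
        Tendsto (t.pi K) atTop (𝓝 ps) ∧
        ps ∈ InertialADMM.subdiff g xs ∧ -ps ∈ InertialADMM.subdiff f xs) ∧
    (∀ K l, t.StopsAt P g F K l →
      t.xi K l = t.zi K l ∧ InertialADMM.IsSolution f g (t.xi K l)) := by
  refine ⟨fun h => ?_, fun K h hσ => ?_, fun K l h => h.eq_and_isSolution hf hg hF⟩
  · obtain ⟨xs, ps, hKT, hx, hz, hp⟩ := h.converges hf hg hsol hF hα
      (InertialADMM.inertia_lt_relaxation P.α_nonneg hαβ hβ hρ)
    exact ⟨xs, ps, hKT.isSolution, hx, hz, hp, hKT.2, hKT.1⟩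
  · obtain ⟨xs, ps, hKT, hx, hz, hp⟩ := h.converges hσ hf hg hsol hF
    exact ⟨xs, ps, hKT.isSolution, hx, hz, hp, hKT.2, hKT.1⟩
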